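/- Call a map $f:\mathbb{R}^n\to\mathbb{R}^n$ \emph{monotone} if $x\le y$ (entrywise) implies $f(x)\le f(y)$, \emph{homogeneous} if $f(c+x)=c+f(x)$ for all $c\in\mathbb{R}$, $x\in\mathbb{R}^n$, where $c+x=(c+x_1,\dots,c+x_n)$, and \emph{convex} if its coordinates are convex. An \emph{eigenvector} of $f$ is a $v\in\mathbb{R}^n$ with $f(v)=c+v$ for some $c\in\mathbb{R}$. The subdifferential of $f$ at $x$ is $$\partial f(x)=\{P\in\mathbb{R}^{n\times n} : f(y)-f(x)\ge P(y-x)\ \text{ for all } y\in\mathbb{R}^n\}.$$ The graph of an $n\times n$ matrix $P$ has nodes $1,\dots,n$ and an arc $i\to j$ whenever $P_{ij}\neq 0$. Its classes are the equivalence classes of mutual access (each node having access to itself), and a class is \emph{final} if no node of it has access to a node outside it. The \emph{final graph} of $P$ consists of the nodes belonging to final classes of $P$, and of the arcs of the graph of $P$ joining two nodes of the same final class. If $f$ is convex, monotone and homogeneous and has an eigenvector $v$, the \emph{critical graph} $\mathcal{G}^{c}(f)$ of $f$ is the union of the final graphs of the matrices $P\in\partial f(v)$; it does not depend on the choice of the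 eigenvector $v$. Its nodes are called the critical nodes of $f$, and their set is denoted by $N^{c}(f)$. Finally, for a directed graph $\mathcal{G}$ and $k\ge 1$, $\mathcal{G}^k$ is the graph with the same nodes as $\mathcal{G}$ and with an arc $i\to j$ whenever there is a directed path of length $k$ from $i$ to $j$ in $\mathcal{G}$. \textbf{Theorem.} Let $f:\mathbb{R}^n\to\mathbb{R}^n$ be a convex monotone homogeneous map that has an eigenvector. Then, for all $k\ge 1$, the $k$-th iterate $f^k$ also has an eigenvector, and $$\mathcal{G}^{c}(f^k)=\mathcal{G}^{c}(f)^k ,$$ where the two critical graphs may be computed at any eigenvector of $f^k$ and at any eigenvector of $f$, respectively. In particular, $N^{c}(f^k)=N^{c}(f)$. -/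

import Mathlib

namespace ConvexSpectral

/-- A directed graph (loops allowed) given by a set of nodes, taken inside an ambient type `V`, and
a set of arcs joining nodes. -/
@[ext]
structure NodeDigraph (V : Type*) where
  /-- The set of nodes. -/
  nodes : Set V
  /-- `Arc i j` means that `i → j` is an arc. -/
  Arc : V → V → Prop
  left_mem : ∀ {i j : V}, Arc i j → i ∈ nodes
  right_mem : ∀ {i j : V}, Arc i j → j ∈ nodes

namespace NodeDigraph

variable {V : Type*}

/-- `i` has access to `j`: there is a directed path from `i` to `j`, or `i = j`. -/
def HasAccess (G : NodeDigraph V) (i j : V) : Prop :=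
  Relation.ReflTransGen G.Arc i j

/-- The classes of `G`: the equivalence classes, in the set of nodes, of mutual access. -/
def classes (G : NodeDigraph V) : Set (Set V) :=
  {C | ∃ i ∈ G.nodes, C = {j | j ∈ G.nodes ∧ G.HasAccess i j ∧ G.HasAccess j i}}

/-- The final classes of `G`: the classes `C` such that no node of `C` has access to a node outside
`C`. -/
def finalClasses (G : NodeDigraph V) : Set (Set V) :=
  {C | C ∈ G.classes ∧ ∀ i ∈ C, ∀ j ∈ G.nodes, G.HasAccess i j → j ∈ C}

/-- The restriction of `G` to a set `C` of nodes. -/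
def restrict (G : NodeDigraph V) (C : Set V) : NodeDigraph V where
  nodes := G.nodes ∩ C
  Arc i j := G.Arc i j ∧ i ∈ C ∧ j ∈ C
  left_mem h := ⟨G.left_mem h.1, h.2.1⟩
  right_mem h := ⟨G.right_mem h.1, h.2.2⟩

/-- The union of a set of graphs: nodes and arcs are those of the members. -/
def sUnion (S : Set (NodeDigraph V)) : NodeDigraph V where
  nodes := {i | ∃ G ∈ S, i ∈ G.nodes}
  Arc i j := ∃ G ∈ S, G.Arc i j
  left_mem := fun ⟨G, hG, h⟩ => ⟨G, hG, G.left_mem h⟩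
  right_mem := fun ⟨G, hG, h⟩ => ⟨G, hG, G.right_mem h⟩

/-- `G.HasPath k i j`: there is a directed path `i → i₁ → ⋯ → i_k = j` of length `k` in `G`. -/
def HasPath (G : NodeDigraph V) : ℕ → V → V → Prop
  | 0, i, j => i ∈ G.nodes ∧ i = j
  | k + 1, i, j => ∃ l, G.HasPath k i l ∧ G.Arc l j

theorem HasPath.left_mem {G : NodeDigraph V} :
    ∀ {k : ℕ} {i j : V}, G.HasPath k i j → i ∈ G.nodes
  | 0, _, _, h => h.1
  | _ + 1, _, _, ⟨_, h, _⟩ => HasPath.left_mem h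

theorem HasPath.right_mem {G : NodeDigraph V} :
    ∀ {k : ℕ} {i j : V}, G.HasPath k i j → j ∈ G.nodes
  | 0, _, _, h => h.2 ▸ h.1
  | _ + 1, _, _, ⟨_, _, h⟩ => G.right_mem h

/-- The power `G ^ k`: same nodes as `G`, and an arc `i → j` for every directed path of length `k`
from `i` to `j` in `G`. -/
instance : Pow (NodeDigraph V) ℕ where
  pow G k :=
    { nodes := G.nodes
      Arc := G.HasPath k
      left_mem := HasPath.left_mem
      right_mem := HasPath.right_mem }

end NodeDigraph

/-- The graph of an `n × n` matrix `P`: nodes `1, …, n`, arcs `i → j` when `P i j ≠ 0`. -/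
def matrixGraph {n : ℕ} (P : Matrix (Fin n) (Fin n) ℝ) : NodeDigraph (Fin n) where
  nodes := Set.univ
  Arc i j := P i j ≠ 0
  left_mem _ := Set.mem_univ _
  right_mem _ := Set.mem_univ _

/-- The final graph of `P`: the union, over the final classes `F` of `P`, of the restrictions to `F`
of the graph of `P`. -/
def finalGraph {n : ℕ} (P : Matrix (Fin n) (Fin n) ℝ) : NodeDigraph (Fin n) :=
  NodeDigraph.sUnion ((matrixGraph P).restrict '' (matrixGraph P).finalClasses)

/-- A map `ℝⁿ → ℝⁿ` is convex when its coordinates are convex. -/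
def IsConvexMap {n : ℕ} (f : (Fin n → ℝ) → (Fin n → ℝ)) : Prop :=
  ∀ i, ConvexOn ℝ Set.univ (fun x => f x i)

/-- Additive homogeneity: `f (c + x) = c + f x` for all real constants `c`. -/
def IsAddHomogeneous {n : ℕ} (f : (Fin n → ℝ) → (Fin n → ℝ)) : Prop :=
  ∀ (c : ℝ) (x : Fin n → ℝ), f (fun i => c + x i) = fun i => c + f x i

/-- `v` is an (additive) eigenvector of `f`: `f v = c + v` for some real `c`, the eigenvalue. -/
def IsEigenvector {n : ℕ} (f : (Fin n → ℝ) → (Fin n → ℝ)) (v : Fin n → ℝ) : Prop :=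
  ∃ c : ℝ, f v = fun i => c + v i

/-- The subdifferential of `f` at `x`: the matrices `P` with `f y - f x ≥ P (y - x)`, entrywise, for
all `y`. -/
def subdifferential {n : ℕ} (f : (Fin n → ℝ) → (Fin n → ℝ)) (x : Fin n → ℝ) :
    Set (Matrix (Fin n) (Fin n) ℝ) :=
  {P | ∀ y, P.mulVec (y - x) ≤ f y - f x}

/-- The critical graph of `f`, computed at the eigenvector `v` of `f`: the union of the final graphs
of the matrices of the subdifferential of `f` at `v`. -/
def criticalGraph {n : ℕ} (f : (Fin n → ℝ) → (Fin n → ℝ)) (v : Fin n → ℝ) :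
    NodeDigraph (Fin n) :=
  NodeDigraph.sUnion (finalGraph '' subdifferential f v)

/-- The critical nodes of `f`, computed at the eigenvector `v` of `f`. -/
def criticalNodes {n : ℕ} (f : (Fin n → ℝ) → (Fin n → ℝ)) (v : Fin n → ℝ) : Set (Fin n) :=
  (criticalGraph f v).nodes

end ConvexSpectral

/-!
The proof rests on flows: nonnegative matrices whose rows are nonnegative multiples of subgradients
of the coordinates of `f` at the eigenvector. They form a convex cone, and so do the circulations,
the flows whose row sums equal the corresponding column sums. A circulation is `diag(m) P` with
`P ∈ ∂f(v)` and `m` an invariant measure of `P`; since invariant measures live on final classes, and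
every final class carries one, the arcs of the critical graph are the arcs used by circulations.

* The circulations are the same at all eigenvectors, because the subgradient inequalities between
  two eigenvectors, summed over a circulation, are equalities.
* A sum of circulations using all critical arcs is of the form `diag(m) P`; as `P ^ k ∈ ∂f^k(v)` has
  the same invariant measure, paths of length `k` in the critical graph are critical arcs of `f^k`.
* Conversely, the chain rule for subdifferentials unfolds a subgradient of a coordinate of `f^k`
  into a flow along paths of length `k`. Unfolding all the rows of a circulation of `f^k` yields a
  circulation of `f`.
-/

namespace ConvexSpectral

open Matrix

/-! ### Subgradients of convex functions -/

section Subgradient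

variable {E : Type*} [AddCommGroup E] [Module ℝ E]

/-- The linear form `l` is a subgradient of `φ` at `x`. Continuity is not part of the definition. -/
def IsSubgradient (φ : E → ℝ) (x : E) (l : Module.Dual ℝ E) : Prop :=
  ∀ y, l (y - x) ≤ φ y - φ x

namespace IsSubgradient

variable {φ : E → ℝ} {x : E} {l : Module.Dual ℝ E}

theorem nonneg_of_monotone [PartialOrder E] [IsOrderedAddMonoid E] (hl : IsSubgradient φ x l)
    (hφ : Monotone φ) {z : E} (hz : 0 ≤ z) : 0 ≤ l z := by
  have hsub := hl (x - z)
  rw [sub_sub_cancel_left, map_neg] at hsub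
  linarith [hφ (sub_le_self x hz)]

theorem apply_eq_of_forall_add_eq (hl : IsSubgradient φ x l) {e : E} {c : ℝ}
    (hφ : ∀ y, φ (y + e) = φ y + c) : l e = c := by
  have hadd := hl (x + e)
  have hsub := hl (x - e)
  have hxe := hφ (x - e)
  rw [add_sub_cancel_left, hφ] at hadd
  rw [sub_sub_cancel_left, map_neg] at hsub
  rw [sub_add_cancel] at hxe
  linarith

theorem add_iff {e : E} {c : ℝ} (hφ : ∀ y, φ (y + e) = φ y + c) :
    IsSubgradient φ (x + e) l ↔ IsSubgradient φ x l := by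
  unfold IsSubgradient
  rw [← (Equiv.addRight e).forall_congr_right]
  simp [hφ]

theorem exists_eq_smul {c : ℝ} (hl : IsSubgradient (c • φ) x l) (hc : 0 ≤ c)
    (hφ : ∃ q, IsSubgradient φ x q) : ∃ q, IsSubgradient φ x q ∧ l = c • q := by
  obtain rfl | hc := hc.eq_or_lt
  · obtain ⟨q, hq⟩ := hφ
    refine ⟨q, hq, LinearMap.ext fun z => ?_⟩
    simpa using hl.apply_eq_of_forall_add_eq (e := z) (c := 0) (by simp)
  · refine ⟨c⁻¹ • l, fun y => ?_, (smul_inv_smul₀ hc.ne' l).symm⟩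
    have := hl y
    rw [Pi.smul_apply, Pi.smul_apply, ← smul_sub] at this
    simpa [inv_mul_le_iff₀ hc] using this

end IsSubgradient

section Topological

variable [TopologicalSpace E] [IsTopologicalAddGroup E] [ContinuousSMul ℝ E]

theorem exists_isSubgradient_of_convex_below {Φ : E → ℝ} (hΦ : ConvexOn ℝ Set.univ Φ)
    (hcont : Continuous Φ) {C : Set (E × ℝ)} (hC : Convex ℝ C) {x : E} (hx : (x, Φ x) ∈ C)
    (hle : ∀ z ∈ C, z.2 ≤ Φ z.1) :
    ∃ l, IsSubgradient Φ x l ∧ ∀ z ∈ C, z.2 ≤ Φ x + l (z.1 - x) := by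
  have hepi : Convex ℝ {z : E × ℝ | Φ z.1 < z.2} := by simpa using hΦ.convex_strict_epigraph
  obtain ⟨g, u, hgepi, hgC⟩ := geometric_hahn_banach_open hepi
    (isOpen_lt (by fun_prop) (by fun_prop)) hC
    (Set.disjoint_left.2 fun z hz hzC => (hle z hzC).not_gt hz)
  let h : Module.Dual ℝ E := g.toLinearMap ∘ₗ LinearMap.inl ℝ E ℝ
  set a := g (0, 1)
  have hg (z : E) (t : ℝ) : g (z, t) = h z + t * a := by
    have : ((z, t) : E × ℝ) = (z, 0) + t • (0, 1) := by simp
    rw [this, map_add, map_smul, smul_eq_mul]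
    rfl
  have ha : 0 < -a := by
    have h₁ := hgC _ hx
    have h₂ := hgepi (x, Φ x + 1) (lt_add_one (Φ x))
    rw [hg] at h₁ h₂
    linarith
  let l : Module.Dual ℝ E := (-a)⁻¹ • h
  have hl (z : E) : l z - (-a)⁻¹ * u = (-a)⁻¹ * (h z - u) := (mul_sub _ _ _).symm
  have hlΦ (z : E) : l z - (-a)⁻¹ * u ≤ Φ z := by
    refine le_of_forall_gt fun t ht => ?_
    have := hgepi (z, t) ht
    rw [hg] at this
    rw [hl, inv_mul_lt_iff₀ ha]
    linarith
  have hlC (z) (hz : z ∈ C) : z.2 ≤ l z.1 - (-a)⁻¹ * u := by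
    have := hgC z hz
    rw [← Prod.mk.eta (p := z), hg] at this
    rw [hl, le_inv_mul_iff₀ ha]
    linarith
  have hlx : l x - (-a)⁻¹ * u = Φ x := (hlΦ x).antisymm (hlC _ hx)
  refine ⟨l, fun y => ?_, fun z hz => ?_⟩
  · linarith [hlΦ y, map_sub l y x]
  · linarith [hlC z hz, map_sub l z.1 x]

theorem exists_isSubgradient {φ : E → ℝ} (hφ : ConvexOn ℝ Set.univ φ) (hcont : Continuous φ)
    (x : E) : ∃ l, IsSubgradient φ x l := by
  obtain ⟨l, hl, -⟩ := exists_isSubgradient_of_convex_below hφ hcont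
    (convex_singleton (x, φ x)) rfl (by simp)
  exact ⟨l, hl⟩

theorem IsSubgradient.exists_eq_sum {ι : Type*} [Fintype ι] {φ : ι → E → ℝ}
    (hφ : ∀ i, ConvexOn ℝ Set.univ (φ i)) (hcont : ∀ i, Continuous (φ i)) {x : E}
    {l : Module.Dual ℝ E} (hl : IsSubgradient (∑ i, φ i) x l) :
    ∃ q : ι → Module.Dual ℝ E, (∀ i, IsSubgradient (φ i) x (q i)) ∧ l = ∑ i, q i := by
  classical
  let Φ : (ι → E) → ℝ := fun Y => ∑ i, φ i (Y i)
  have hΦ : ConvexOn ℝ Set.univ Φ := by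
    refine ⟨convex_univ, fun Y _ Z _ a b ha hb hab => ?_⟩
    simp only [Φ, Finset.smul_sum, ← Finset.sum_add_distrib]
    exact Finset.sum_le_sum fun i _ =>
      (hφ i).2 (Set.mem_univ (Y i)) (Set.mem_univ (Z i)) ha hb hab
  -- `l` is a linear form on the diagonal; separating its graph from `Φ` extends it to `ι → E`.
  let C : Set ((ι → E) × ℝ) := Set.range fun y => (fun _ => y, Φ (fun _ => x) + l (y - x))
  have hC : Convex ℝ C := by
    rintro _ ⟨y, rfl⟩ _ ⟨z, rfl⟩ a b - - hab
    refine ⟨a • y + b • z, Prod.ext rfl ?_⟩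
    simp only [map_sub, map_add, map_smul, Prod.snd_add, Prod.smul_snd, smul_eq_mul]
    linear_combination (l x - Φ fun _ => x) * hab
  obtain ⟨L, hL, hLC⟩ := exists_isSubgradient_of_convex_below hΦ (by fun_prop) hC
    (x := fun _ => x) ⟨x, by simp⟩ (by
      rintro _ ⟨y, rfl⟩
      have := hl y
      simp only [Finset.sum_apply] at this
      linarith)
  refine ⟨fun i => L ∘ₗ LinearMap.single ℝ (fun _ => E) i, fun i y => ?_, ?_⟩
  · calc L (Pi.single i (y - x))
        = L ((fun _ => x) + Pi.single i (y - x) - fun _ => x) := by rw [add_sub_cancel_left]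
      _ ≤ ∑ j, φ j (x + (Pi.single i (y - x) : ι → E) j) - ∑ j, φ j x := hL _
      _ = ∑ j, (φ j (x + (Pi.single i (y - x) : ι → E) j) - φ j x) :=
          (Finset.sum_sub_distrib ..).symm
      _ = φ i y - φ i x := by
          rw [Fintype.sum_eq_single i fun j hj => by simp [Pi.single_eq_of_ne hj]]
          simp
  · have hle (z : E) : l z ≤ L fun _ => z := by
      simpa [Pi.sub_def] using hLC _ ⟨x + z, rfl⟩
    have hge (z : E) : L (fun _ => z) ≤ l z := by
      have hneg : L (fun _ => -z) = -L fun _ => z := map_neg L fun _ => z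
      have := hle (-z)
      rw [map_neg, hneg] at this
      exact neg_le_neg_iff.1 this
    refine LinearMap.ext fun z => ?_
    calc l z = L fun _ => z := (hle z).antisymm (hge z)
      _ = L (∑ i, Pi.single i z) := by rw [Finset.univ_sum_single fun _ : ι => z]
      _ = _ := by simp

end Topological

theorem IsSubgradient.exists_comp {F : Type*} [AddCommGroup F] [PartialOrder F]
    [IsOrderedAddMonoid F] [Module ℝ F] [PosSMulMono ℝ F] [TopologicalSpace F]
    [IsTopologicalAddGroup F] [ContinuousSMul ℝ F] {φ : F → ℝ} (hφ : ConvexOn ℝ Set.univ φ)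
    (hcont : Continuous φ) (hmono : Monotone φ) {f : E → F} (hf : ConvexOn ℝ Set.univ f) {x : E}
    {l : Module.Dual ℝ E} (hl : IsSubgradient (φ ∘ f) x l) :
    ∃ p, IsSubgradient φ (f x) p ∧ IsSubgradient (p ∘ f) x l := by
  -- The hypograph of `z ↦ sup {φ (f x) + l (y - x) | f y ≤ z}`.
  let C : Set (F × ℝ) := {z | ∃ y, f y ≤ z.1 ∧ z.2 ≤ φ (f x) + l (y - x)}
  have hC : Convex ℝ C := by
    rintro z ⟨y, hyz, hzy⟩ z' ⟨y', hyz', hzy'⟩ a b ha hb hab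
    refine ⟨a • y + b • y', ?_, ?_⟩
    · calc f (a • y + b • y') ≤ a • f y + b • f y' :=
            hf.2 (Set.mem_univ y) (Set.mem_univ y') ha hb hab
        _ ≤ a • z.1 + b • z'.1 := by gcongr
    · calc a * z.2 + b * z'.2
          ≤ a * (φ (f x) + l (y - x)) + b * (φ (f x) + l (y' - x)) := by gcongr
        _ = φ (f x) + l (a • y + b • y' - x) := by
            simp only [map_sub, map_add, map_smul, smul_eq_mul]
            linear_combination (φ (f x) - l x) * hab
  obtain ⟨p, hp, hpC⟩ := exists_isSubgradient_of_convex_below hφ hcont hC (x := f x)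
    ⟨x, le_rfl, by simp⟩ (by
      rintro z ⟨y, hyz, hzy⟩
      have := hl y
      simp only [Function.comp_apply] at this
      linarith [hmono hyz])
  refine ⟨p, hp, fun y => ?_⟩
  have := hpC (f y, φ (f x) + l (y - x)) ⟨y, le_rfl, le_rfl⟩
  simpa using this

end Subgradient

/-! ### Subdifferentials of convex maps -/

section Subdifferential

variable {n : ℕ} {f g : (Fin n → ℝ) → (Fin n → ℝ)} {v x : Fin n → ℝ}
  {P Q : Matrix (Fin n) (Fin n) ℝ}

theorem isConvexMap_iff : IsConvexMap f ↔ ConvexOn ℝ Set.univ f :=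
  ⟨fun h => ⟨convex_univ, fun _ hx _ hy _ _ ha hb hab i => (h i).2 hx hy ha hb hab⟩,
    fun h i => ⟨convex_univ, fun _ hx _ hy _ _ ha hb hab => h.2 hx hy ha hb hab i⟩⟩

theorem IsConvexMap.iterate (hf : IsConvexMap f) (hmono : Monotone f) (k : ℕ) :
    IsConvexMap f^[k] := by
  rw [isConvexMap_iff] at hf ⊢
  induction k with
  | zero => exact convexOn_id convex_univ
  | succ k ih =>
    rw [Function.iterate_succ']
    exact ⟨convex_univ, fun y hy z hz a b ha hb hab =>
      (hmono (ih.2 hy hz ha hb hab)).trans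
        (hf.2 (Set.mem_univ _) (Set.mem_univ _) ha hb hab)⟩

theorem IsConvexMap.continuous_apply (hf : IsConvexMap f) (i : Fin n) :
    Continuous fun y => f y i :=
  continuousOn_univ.1 ((hf i).continuousOn isOpen_univ)

theorem IsAddHomogeneous.add_smul_one (hf : IsAddHomogeneous f) (c : ℝ) (y : Fin n → ℝ)
    (i : Fin n) : f (y + c • 1) i = f y i + c := by
  have : y + c • 1 = fun j => c + y j := by ext j; simp [add_comm]
  rw [this, hf, add_comm]

theorem mem_subdifferential_iff :
    P ∈ subdifferential f x ↔
      ∀ i, IsSubgradient (fun y => f y i) x (dotProductEquiv ℝ (Fin n) (P i)) :=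
  forall_comm

theorem IsSubgradient.nonneg {φ : (Fin n → ℝ) → ℝ} {p : Fin n → ℝ}
    (hp : IsSubgradient φ x (dotProductEquiv ℝ (Fin n) p)) (hφ : Monotone φ) : 0 ≤ p := fun j => by
  simpa using hp.nonneg_of_monotone hφ (Pi.single_nonneg.2 (zero_le_one' ℝ) : 0 ≤ Pi.single j 1)

theorem exists_mem_subdifferential {l : Fin n → Module.Dual ℝ (Fin n → ℝ)}
    (hl : ∀ i, IsSubgradient (fun y => f y i) x (l i)) :
    ∃ P ∈ subdifferential f x, ∀ i, dotProductEquiv ℝ (Fin n) (P i) = l i := by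
  choose P hP using fun i => (dotProductEquiv ℝ (Fin n)).surjective (l i)
  exact ⟨P, mem_subdifferential_iff.2 fun i => hP i ▸ hl i, hP⟩

theorem IsConvexMap.exists_isSubgradient (hf : IsConvexMap f) (x : Fin n → ℝ) (i : Fin n) :
    ∃ l, IsSubgradient (fun y => f y i) x l :=
  ConvexSpectral.exists_isSubgradient (hf i) (hf.continuous_apply i) x

theorem mem_rowStochastic_of_mem_subdifferential (hmono : Monotone f) (hhom : IsAddHomogeneous f)
    (hP : P ∈ subdifferential f x) : P ∈ rowStochastic ℝ (Fin n) := by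
  rw [mem_subdifferential_iff] at hP
  refine mem_rowStochastic.2 ⟨fun i j => ?_, funext fun i => ?_⟩
  · exact (hP i).nonneg (fun _ _ h => hmono h i) j
  · exact (hP i).apply_eq_of_forall_add_eq fun y => by simpa using hhom.add_smul_one 1 y i

theorem mul_mem_subdifferential_comp (hQ : Q ∈ subdifferential g (f x))
    (hQ₀ : ∀ i j, 0 ≤ Q i j) (hP : P ∈ subdifferential f x) :
    Q * P ∈ subdifferential (g ∘ f) x := fun y => calc
  (Q * P) *ᵥ (y - x) = Q *ᵥ (P *ᵥ (y - x)) := (mulVec_mulVec ..).symm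
  _ ≤ Q *ᵥ (f y - f x) := fun i => dotProduct_le_dotProduct_of_nonneg_left (hP y) (hQ₀ i)
  _ ≤ g (f y) - g (f x) := hQ (f y)

theorem IsSubgradient.exists_eq_vecMul {φ : (Fin n → ℝ) → ℝ} (hφ : ConvexOn ℝ Set.univ φ)
    (hcont : Continuous φ) (hmono : Monotone φ) (hf : IsConvexMap f)
    {r : Fin n → ℝ} (hr : IsSubgradient (φ ∘ f) x (dotProductEquiv ℝ (Fin n) r)) :
    ∃ p, IsSubgradient φ (f x) (dotProductEquiv ℝ (Fin n) p) ∧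
      ∃ Q ∈ subdifferential f x, r = p ᵥ* Q := by
  obtain ⟨l, hp, hlf⟩ := hr.exists_comp hφ hcont hmono (isConvexMap_iff.1 hf)
  obtain ⟨p, rfl⟩ := (dotProductEquiv ℝ (Fin n)).surjective l
  have hp₀ : 0 ≤ p := hp.nonneg hmono
  have hsum : dotProductEquiv ℝ (Fin n) p ∘ f = ∑ j, p j • fun y => f y j := by
    ext y
    simp [dotProduct]
  rw [hsum] at hlf
  obtain ⟨q, hq, hrq⟩ := hlf.exists_eq_sum (fun j => (hf j).smul (hp₀ j))
    fun j => (hf.continuous_apply j).const_smul (p j)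
  choose l hl hql using fun j => (hq j).exists_eq_smul (hp₀ j) (hf.exists_isSubgradient x j)
  obtain ⟨Q, hQ, hQl⟩ := exists_mem_subdifferential hl
  refine ⟨p, hp, Q, hQ, (dotProductEquiv ℝ (Fin n)).injective ?_⟩
  rw [hrq, vecMul_eq_sum, map_sum]
  exact Finset.sum_congr rfl fun j _ => by rw [hql, ← hQl, ← map_smul]

end Subdifferential

/-! ### Classes and paths of directed graphs -/

namespace NodeDigraph

variable {V : Type*} {G H : NodeDigraph V} {i j : V}

theorem nonempty_of_mem_classes {C : Set V} (hC : C ∈ G.classes) : C.Nonempty := by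
  obtain ⟨i, hi, rfl⟩ := hC
  exact ⟨i, hi, .refl, .refl⟩

theorem hasAccess_of_mem_classes {C : Set V} (hC : C ∈ G.classes) (hi : i ∈ C) (hj : j ∈ C) :
    G.HasAccess i j := by
  obtain ⟨i₀, -, rfl⟩ := hC
  exact hi.2.2.trans hj.2.1

theorem setOf_hasAccess_mem_finalClasses (hi : i ∈ G.nodes)
    (hsymm : ∀ j, G.HasAccess i j → G.HasAccess j i) :
    {j | G.HasAccess i j} ∈ G.finalClasses := by
  have hmem (j) (hij : G.HasAccess i j) : j ∈ G.nodes := by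
    induction hij with
    | refl => exact hi
    | tail _ harc => exact G.right_mem harc
  exact ⟨⟨i, hi, Set.ext fun j => ⟨fun hj => ⟨hmem j hj, hj, hsymm j hj⟩, fun hj => hj.2.1⟩⟩,
    fun _ ha _ _ hab => Relation.ReflTransGen.trans ha hab⟩

theorem HasPath.mono (hGH : ∀ i j, G.Arc i j → H.Arc i j) (hi : i ∈ H.nodes) {k : ℕ}
    (h : G.HasPath k i j) : H.HasPath k i j := by
  induction k generalizing j with
  | zero => exact ⟨hi, h.2⟩
  | succ k ih =>
    obtain ⟨l, hil, hlj⟩ := h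
    exact ⟨l, ih hil, hGH l j hlj⟩

theorem HasPath.exists_arc_left {k : ℕ} (h : G.HasPath (k + 1) i j) : ∃ l, G.Arc i l := by
  induction k generalizing j with
  | zero =>
    obtain ⟨l, ⟨-, rfl⟩, hlj⟩ := h
    exact ⟨j, hlj⟩
  | succ k ih =>
    obtain ⟨l, hil, -⟩ := h
    exact ih hil

theorem exists_hasPath (hG : ∀ i ∈ G.nodes, ∃ j, G.Arc i j) (hi : i ∈ G.nodes) (k : ℕ) :
    ∃ j, G.HasPath k i j := by
  induction k with
  | zero => exact ⟨i, hi, rfl⟩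
  | succ k ih =>
    obtain ⟨l, hl⟩ := ih
    obtain ⟨j, hj⟩ := hG l hl.right_mem
    exact ⟨j, l, hl, hj⟩

end NodeDigraph

/-! ### Final classes and invariant measures -/

section Matrix

variable {V : Type*} [Fintype V]

theorem sum_cut_eq_sum_cut [DecidableEq V] {R : Type*} [NonAssocRing R] {F : Matrix V V R}
    (hbal : F *ᵥ 1 = 1 ᵥ* F) (S : Finset V) :
    ∑ a ∈ S, ∑ b ∈ Sᶜ, F a b = ∑ a ∈ Sᶜ, ∑ b ∈ S, F a b := by
  have hS : ∑ a ∈ S, ∑ b, F a b = ∑ b ∈ S, ∑ a, F a b :=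
    Finset.sum_congr rfl fun a _ => by simpa [mulVec, vecMul, dotProduct] using congr_fun hbal a
  simp only [← Finset.sum_add_sum_compl S, Finset.sum_add_distrib] at hS
  rw [Finset.sum_comm (s := S) (t := S), Finset.sum_comm (s := S) (t := Sᶜ)
    (f := fun b a => F a b)] at hS
  exact add_left_cancel hS

theorem diagonal_mul_mulVec_one [DecidableEq V] {W R : Type*} [Fintype W] [Semiring R]
    {P : Matrix V W R} (m : V → R) (hP : P *ᵥ 1 = 1) : (diagonal m * P) *ᵥ 1 = m := by
  rw [← mulVec_mulVec, hP]
  ext i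
  simp [mulVec_diagonal]

theorem one_vecMul_diagonal_mul [DecidableEq V] {W R : Type*} [Semiring R] (m : V → R)
    (P : Matrix V W R) : 1 ᵥ* (diagonal m * P) = m ᵥ* P := by
  rw [← vecMul_vecMul]
  congr 1
  ext i
  simp [vecMul_diagonal]

theorem exists_ne_zero_vecMul_eq_self {K : Type*} [CommRing K] [IsDomain K] {P : Matrix V V K}
    (hP : P *ᵥ 1 = 1) {C : Set V} (hC : C.Nonempty) (hclosed : ∀ a ∈ C, ∀ b ∉ C, P a b = 0) :
    ∃ x ≠ 0, x ᵥ* P = x ∧ ∀ b ∉ C, x b = 0 := by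
  classical
  -- Erasing the rows of `P` outside `C` leaves the columns inside `C` only. The erased matrix fixes
  -- the column vector `χ`, so `1` is an eigenvalue and it fixes some row vector too.
  let χ : V → K := C.indicator 1
  have hχ : (diagonal χ * P) *ᵥ χ = χ := by
    ext a
    rw [← mulVec_mulVec, mulVec_diagonal]
    by_cases ha : a ∈ C
    · have : (P *ᵥ χ) a = (P *ᵥ 1) a := Finset.sum_congr rfl fun b _ => by
        by_cases hb : b ∈ C <;> simp [χ, hb, hclosed a ha b]
      rw [this, hP, Pi.one_apply, mul_one]
    · simp [χ, ha]
  have hχ₀ : χ ≠ 0 := by simpa [χ, Set.indicator_eq_zero] using hC.ne_empty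
  obtain ⟨x, hx₀, hx⟩ := exists_vecMul_eq_zero_iff.2
    (exists_mulVec_eq_zero_iff.1 ⟨χ, hχ₀, by rw [sub_mulVec, hχ, one_mulVec, sub_self]⟩ :
      (diagonal χ * P - 1).det = 0)
  replace hx : x ᵥ* (diagonal χ * P) = x := by
    rwa [vecMul_sub, vecMul_one, sub_eq_zero] at hx
  have hsupp (b) (hb : b ∉ C) : x b = 0 := by
    rw [← hx]
    refine Finset.sum_eq_zero fun a _ => ?_
    by_cases ha : a ∈ C
    · simp [hclosed a ha b hb]
    · simp [χ, ha]
  refine ⟨x, hx₀, ?_, hsupp⟩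
  have hxχ : x ᵥ* diagonal χ = x := by
    ext a
    by_cases ha : a ∈ C <;> simp [vecMul_diagonal, χ, ha, hsupp a]
  rwa [← vecMul_vecMul, hxχ] at hx

theorem abs_vecMul_eq_self [DecidableEq V] {R : Type*} [Ring R] [LinearOrder R]
    [IsStrictOrderedRing R] {P : Matrix V V R} (hP : P ∈ rowStochastic R V) {x : V → R}
    (hx : x ᵥ* P = x) : |x| ᵥ* P = |x| := by
  have hle (b : V) : |x| b ≤ (|x| ᵥ* P) b := calc
    |x| b = |∑ a, x a * P a b| := by rw [Pi.abs_apply, ← congr_fun hx b]; rfl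
    _ ≤ ∑ a, |x a * P a b| := Finset.abs_sum_le_sum_abs ..
    _ = (|x| ᵥ* P) b := Finset.sum_congr rfl fun a _ => by
      rw [abs_mul, abs_of_nonneg (nonneg_of_mem_rowStochastic hP), Pi.abs_apply]
  have hsum : ∑ b, |x| b = ∑ b, (|x| ᵥ* P) b := by
    have := dotProduct_mulVec |x| P 1
    rwa [one_vecMul_of_mem_rowStochastic hP, dotProduct_one, dotProduct_one] at this
  exact funext fun b =>
    ((Finset.sum_eq_sum_iff_of_le fun b _ => hle b).1 hsum b (Finset.mem_univ b)).symm

end Matrix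

section FinalClasses

variable {n : ℕ} {P F : Matrix (Fin n) (Fin n) ℝ} {m : Fin n → ℝ} {i j : Fin n}

theorem hasAccess_symm_of_circulation (hF : ∀ a b, 0 ≤ F a b) (hbal : F *ᵥ 1 = 1 ᵥ* F)
    (h : (matrixGraph F).HasAccess i j) : (matrixGraph F).HasAccess j i := by
  classical
  induction h with
  | refl => exact .refl
  | @tail a b _ hab ih =>
    refine Relation.ReflTransGen.trans ?_ ih
    by_contra hba : ¬(matrixGraph F).HasAccess b a
    let S : Finset (Fin n) := {c | (matrixGraph F).HasAccess b c}
    have hout : ∑ c ∈ S, ∑ d ∈ Sᶜ, F c d = 0 :=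
      Finset.sum_eq_zero fun c hc => Finset.sum_eq_zero fun d hd => by
        simp only [S, Finset.mem_compl, Finset.mem_filter_univ] at hc hd
        by_contra hcd
        exact hd (Relation.ReflTransGen.tail hc hcd)
    have hin : 0 < ∑ c ∈ Sᶜ, ∑ d ∈ S, F c d :=
      Finset.sum_pos' (fun c _ => Finset.sum_nonneg fun d _ => hF c d)
        ⟨a, by simp [S, hba], Finset.sum_pos' (fun d _ => hF a d)
          ⟨b, (Finset.mem_filter_univ b).2 .refl, (hF a b).lt_of_ne' hab⟩⟩
    exact hin.ne' ((sum_cut_eq_sum_cut hbal S).symm.trans hout)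

theorem pos_of_invariant_of_hasAccess (hP : ∀ a b, 0 ≤ P a b) (hm : 0 ≤ m) (hinv : m ᵥ* P = m)
    (hi : 0 < m i) (h : (matrixGraph P).HasAccess i j) : 0 < m j := by
  induction h with
  | refl => exact hi
  | @tail a b _ hab ih =>
    rw [← hinv]
    exact Finset.sum_pos' (fun c _ => mul_nonneg (hm c) (hP c b))
      ⟨a, Finset.mem_univ a, mul_pos ih ((hP a b).lt_of_ne' hab)⟩

theorem finalGraph_arc_of_invariant (hP : P ∈ rowStochastic ℝ (Fin n)) (hm : 0 ≤ m)
    (hinv : m ᵥ* P = m) (hi : 0 < m i) (hij : P i j ≠ 0) : (finalGraph P).Arc i j := by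
  have hP₀ (a b) : 0 ≤ P a b := nonneg_of_mem_rowStochastic hP
  have hto (a) (h : (matrixGraph P).HasAccess i a) :
      (matrixGraph (diagonal m * P)).HasAccess i a := by
    induction h with
    | refl => exact .refl
    | @tail a b hia hab ih =>
      refine ih.tail ?_
      simpa [matrixGraph] using ⟨(pos_of_invariant_of_hasAccess hP₀ hm hinv hi hia).ne', hab⟩
  have hfrom {a b} (h : (matrixGraph (diagonal m * P)).HasAccess a b) :
      (matrixGraph P).HasAccess a b :=
    Relation.ReflTransGen.mono (fun a b hab => by simp_all [matrixGraph]) a b h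
  have hF₀ (a b) : 0 ≤ (diagonal m * P) a b := by
    simpa using mul_nonneg (hm a) (hP₀ a b)
  have hbal : (diagonal m * P) *ᵥ 1 = 1 ᵥ* (diagonal m * P) := by
    rw [diagonal_mul_mulVec_one m (one_vecMul_of_mem_rowStochastic hP), one_vecMul_diagonal_mul,
      hinv]
  have hsymm (a) (ha : (matrixGraph P).HasAccess i a) : (matrixGraph P).HasAccess a i :=
    hfrom (hasAccess_symm_of_circulation hF₀ hbal (hto a ha))
  exact ⟨_, ⟨_, NodeDigraph.setOf_hasAccess_mem_finalClasses (Set.mem_univ i) hsymm, rfl⟩,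
    hij, .refl, .single hij⟩

theorem exists_invariant_of_mem_finalClasses (hP : P ∈ rowStochastic ℝ (Fin n)) {C : Set (Fin n)}
    (hC : C ∈ (matrixGraph P).finalClasses) :
    ∃ m, 0 ≤ m ∧ m ᵥ* P = m ∧ ∀ i ∈ C, 0 < m i := by
  obtain ⟨x, hx₀, hx, hsupp⟩ := exists_ne_zero_vecMul_eq_self (one_vecMul_of_mem_rowStochastic hP)
    (NodeDigraph.nonempty_of_mem_classes hC.1) fun a ha b hb => not_not.1 fun hab =>
      hb (hC.2 a ha b (Set.mem_univ b) (.single hab))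
  obtain ⟨a, ha⟩ := Function.ne_iff.1 hx₀
  have haC : a ∈ C := not_not.1 (mt (hsupp a) ha)
  have hinv := abs_vecMul_eq_self hP hx
  exact ⟨|x|, abs_nonneg x, hinv, fun i hi =>
    pos_of_invariant_of_hasAccess (fun _ _ => nonneg_of_mem_rowStochastic hP) (abs_nonneg x) hinv
      (abs_pos.2 ha) (NodeDigraph.hasAccess_of_mem_classes hC.1 haC hi)⟩

end FinalClasses

/-! ### Flows and circulations -/

section Flows

variable {n : ℕ} {f : (Fin n → ℝ) → (Fin n → ℝ)} {v w : Fin n → ℝ}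
  {F : Matrix (Fin n) (Fin n) ℝ} {i j : Fin n}

/-- The nonnegative matrices whose `i`-th row is a nonnegative multiple of a subgradient at `v` of
the `i`-th coordinate of `f`. For an additively homogeneous `f` the factor is the `i`-th row sum
`(F *ᵥ 1) i`, whence the condition below, which visibly defines a convex cone. -/
def subgradientFlows (f : (Fin n → ℝ) → (Fin n → ℝ)) (v : Fin n → ℝ) :
    PointedCone ℝ (Matrix (Fin n) (Fin n) ℝ) where
  carrier := {F | (∀ i j, 0 ≤ F i j) ∧ ∀ y, F *ᵥ (y - v) ≤ (F *ᵥ 1) * (f y - f v)}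
  zero_mem' := by simp
  add_mem' := by
    rintro F F' ⟨hF₀, hF⟩ ⟨hF'₀, hF'⟩
    refine ⟨fun i j => add_nonneg (hF₀ i j) (hF'₀ i j), fun y => ?_⟩
    rw [add_mulVec, add_mulVec, add_mul]
    exact add_le_add (hF y) (hF' y)
  smul_mem' := by
    rintro ⟨c, hc⟩ F ⟨hF₀, hF⟩
    change c • F ∈ _
    refine ⟨fun i j => mul_nonneg hc (hF₀ i j), fun y => ?_⟩
    rw [smul_mulVec, smul_mulVec, smul_mul_assoc]
    exact smul_le_smul_of_nonneg_left (hF y) hc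

/-- The flows whose row sums equal the corresponding column sums. -/
def subgradientCirculations (f : (Fin n → ℝ) → (Fin n → ℝ)) (v : Fin n → ℝ) :
    PointedCone ℝ (Matrix (Fin n) (Fin n) ℝ) where
  carrier := {F | F ∈ subgradientFlows f v ∧ F *ᵥ 1 = 1 ᵥ* F}
  zero_mem' := ⟨zero_mem _, by simp⟩
  add_mem' := fun {F F'} hF hF' =>
    ⟨add_mem hF.1 hF'.1, by rw [add_mulVec, vecMul_add, hF.2, hF'.2]⟩
  smul_mem' := fun c F hF => ⟨Submodule.smul_mem _ c hF.1, by
    change ((c : ℝ) • F) *ᵥ 1 = 1 ᵥ* ((c : ℝ) • F)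
    rw [smul_mulVec, vecMul_smul, hF.2]⟩

theorem mem_subgradientFlows_iff (hconv : IsConvexMap f) (hmono : Monotone f)
    (hhom : IsAddHomogeneous f) :
    F ∈ subgradientFlows f v ↔ ∃ m, 0 ≤ m ∧ ∃ P ∈ subdifferential f v, diagonal m * P = F := by
  constructor
  · rintro ⟨hF₀, hF⟩
    have hm : 0 ≤ F *ᵥ 1 := fun i => by
      simpa [mulVec, dotProduct_one] using Finset.sum_nonneg fun j _ => hF₀ i j
    have hrow (i) : IsSubgradient ((F *ᵥ 1) i • fun y => f y i) v
        (dotProductEquiv ℝ (Fin n) (F i)) := fun y => (hF y i).trans_eq (mul_sub ..)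
    choose l hl hlF using fun i => (hrow i).exists_eq_smul (hm i) (hconv.exists_isSubgradient v i)
    obtain ⟨P, hP, hPl⟩ := exists_mem_subdifferential hl
    have hFP (i) : F i = (F *ᵥ 1) i • P i :=
      (dotProductEquiv ℝ (Fin n)).injective (by rw [hlF, ← hPl, map_smul])
    exact ⟨F *ᵥ 1, hm, P, hP, Matrix.ext fun i j =>
      (diagonal_mul ..).trans (congr_fun (hFP i) j).symm⟩
  · rintro ⟨m, hm, P, hP, rfl⟩
    have hstoch := mem_rowStochastic_of_mem_subdifferential hmono hhom hP
    refine ⟨fun i j => ?_, fun y i => ?_⟩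
    · rw [diagonal_mul]
      exact mul_nonneg (hm i) (nonneg_of_mem_rowStochastic hstoch)
    · rw [diagonal_mul_mulVec_one m (one_vecMul_of_mem_rowStochastic hstoch), ← mulVec_mulVec,
        mulVec_diagonal]
      exact mul_le_mul_of_nonneg_left (hP y i) (hm i)

theorem mem_subgradientCirculations_iff (hconv : IsConvexMap f) (hmono : Monotone f)
    (hhom : IsAddHomogeneous f) :
    F ∈ subgradientCirculations f v ↔
      ∃ m, 0 ≤ m ∧ ∃ P ∈ subdifferential f v, m ᵥ* P = m ∧ diagonal m * P = F := by
  have hbal {P} (m) (hP : P ∈ subdifferential f v) :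
      (diagonal m * P) *ᵥ 1 = 1 ᵥ* (diagonal m * P) ↔ m ᵥ* P = m := by
    have hstoch := mem_rowStochastic_of_mem_subdifferential hmono hhom hP
    rw [diagonal_mul_mulVec_one m (one_vecMul_of_mem_rowStochastic hstoch),
      one_vecMul_diagonal_mul, eq_comm]
  constructor
  · rintro ⟨hF, hF₁⟩
    obtain ⟨m, hm, P, hP, rfl⟩ := (mem_subgradientFlows_iff hconv hmono hhom).1 hF
    exact ⟨m, hm, P, hP, (hbal m hP).1 hF₁, rfl⟩
  · rintro ⟨m, hm, P, hP, hinv, rfl⟩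
    exact ⟨(mem_subgradientFlows_iff hconv hmono hhom).2 ⟨m, hm, P, hP, rfl⟩, (hbal m hP).2 hinv⟩

theorem exists_circulation_of_mem_finalClasses (hconv : IsConvexMap f) (hmono : Monotone f)
    (hhom : IsAddHomogeneous f) {P : Matrix (Fin n) (Fin n) ℝ} (hP : P ∈ subdifferential f v)
    {C : Set (Fin n)} (hC : C ∈ (matrixGraph P).finalClasses) :
    ∃ F ∈ subgradientCirculations f v, ∀ i ∈ C, ∀ j, F i j ≠ 0 ↔ P i j ≠ 0 := by
  obtain ⟨m, hm, hinv, hpos⟩ := exists_invariant_of_mem_finalClasses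
    (mem_rowStochastic_of_mem_subdifferential hmono hhom hP) hC
  exact ⟨diagonal m * P, (mem_subgradientCirculations_iff hconv hmono hhom).2
    ⟨m, hm, P, hP, hinv, rfl⟩, fun i hi j => by simp [(hpos i hi).ne']⟩

theorem criticalGraph_arc_iff (hconv : IsConvexMap f) (hmono : Monotone f)
    (hhom : IsAddHomogeneous f) :
    (criticalGraph f v).Arc i j ↔ ∃ F ∈ subgradientCirculations f v, F i j ≠ 0 := by
  constructor
  · rintro ⟨_, ⟨P, hP, rfl⟩, _, ⟨C, hC, rfl⟩, hij, hi, -⟩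
    obtain ⟨F, hF, hFP⟩ := exists_circulation_of_mem_finalClasses hconv hmono hhom hP hC
    exact ⟨F, hF, (hFP i hi j).2 hij⟩
  · rintro ⟨F, hF, hij⟩
    obtain ⟨m, hm, P, hP, hinv, rfl⟩ := (mem_subgradientCirculations_iff hconv hmono hhom).1 hF
    rw [diagonal_mul] at hij
    exact ⟨_, ⟨P, hP, rfl⟩, finalGraph_arc_of_invariant
      (mem_rowStochastic_of_mem_subdifferential hmono hhom hP) hm hinv
      ((hm i).lt_of_ne' (left_ne_zero_of_mul hij)) (right_ne_zero_of_mul hij)⟩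

theorem mem_criticalGraph_nodes_iff (hmono : Monotone f) (hhom : IsAddHomogeneous f) :
    i ∈ (criticalGraph f v).nodes ↔ ∃ j, (criticalGraph f v).Arc i j := by
  refine ⟨?_, fun ⟨j, hij⟩ => NodeDigraph.left_mem _ hij⟩
  rintro ⟨_, ⟨P, hP, rfl⟩, _, ⟨C, hC, rfl⟩, -, hi⟩
  have hP₁ := one_vecMul_of_mem_rowStochastic
    (mem_rowStochastic_of_mem_subdifferential hmono hhom hP)
  obtain ⟨j, -, hij⟩ : ∃ j ∈ Finset.univ, P i j ≠ 0 := Finset.exists_ne_zero_of_sum_ne_zero (by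
    have := congr_fun hP₁ i
    simp only [mulVec, dotProduct_one, Pi.one_apply] at this
    simp [this])
  exact ⟨j, _, ⟨P, hP, rfl⟩, _, ⟨C, hC, rfl⟩, hij, hi,
    hC.2 i hi j (Set.mem_univ j) (.single hij)⟩

theorem exists_maximal_circulation (hconv : IsConvexMap f) (hmono : Monotone f)
    (hhom : IsAddHomogeneous f) (v : Fin n → ℝ) :
    ∃ F ∈ subgradientCirculations f v, ∀ i j, (criticalGraph f v).Arc i j → F i j ≠ 0 := by
  classical
  choose! F hF hFarc using fun (a : Fin n × Fin n) (ha : (criticalGraph f v).Arc a.1 a.2) =>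
    (criticalGraph_arc_iff hconv hmono hhom).1 ha
  let s : Finset (Fin n × Fin n) := {a | (criticalGraph f v).Arc a.1 a.2}
  have hs {a} : a ∈ s ↔ (criticalGraph f v).Arc a.1 a.2 := Finset.mem_filter_univ a
  refine ⟨∑ a ∈ s, F a, sum_mem fun a ha => hF a (hs.1 ha), fun i j hij => ?_⟩
  have hF₀ (a) (ha : a ∈ s) : 0 ≤ F a i j := (hF a (hs.1 ha)).1.1 i j
  rw [Matrix.sum_apply]
  exact (Finset.sum_pos' hF₀ ⟨(i, j), hs.2 hij, (hF₀ _ (hs.2 hij)).lt_of_ne' (hFarc _ hij)⟩).ne'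

end Flows

/-! ### Eigenvectors -/

section Eigenvectors

variable {n : ℕ} {f : (Fin n → ℝ) → (Fin n → ℝ)} {v w : Fin n → ℝ} {c d : ℝ}

theorem eigenvalue_le [Nonempty (Fin n)] (hmono : Monotone f) (hhom : IsAddHomogeneous f)
    (hv : f v = fun i => c + v i) (hw : f w = fun i => d + w i) : d ≤ c := by
  obtain ⟨i, hi⟩ := Finite.exists_max (w - v)
  have hle : w ≤ v + (w - v) i • 1 := fun j => by
    have := hi j
    simp only [Pi.sub_apply] at this
    simp only [Pi.add_apply, Pi.smul_apply, Pi.one_apply, Pi.sub_apply, smul_eq_mul, mul_one]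
    linarith
  have hf := hmono hle i
  rw [hhom.add_smul_one, hv, hw, Pi.sub_apply] at hf
  linarith

theorem IsEigenvector.map_sub_map (hv : IsEigenvector f v) (hw : IsEigenvector f w)
    (hmono : Monotone f) (hhom : IsAddHomogeneous f) : f w - f v = w - v := by
  obtain ⟨c, hc⟩ := hv
  obtain ⟨d, hd⟩ := hw
  ext i
  have : Nonempty (Fin n) := ⟨i⟩
  have hcd : d = c := (eigenvalue_le hmono hhom hc hd).antisymm (eigenvalue_le hmono hhom hd hc)
  rw [hc, hd, hcd]
  simp

theorem subgradientCirculations_le (hmono : Monotone f) (hhom : IsAddHomogeneous f)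
    (hv : IsEigenvector f v) (hw : IsEigenvector f w) :
    subgradientCirculations f v ≤ subgradientCirculations f w := by
  rintro F ⟨⟨hF₀, hF⟩, hbal⟩
  have hle := hF w
  rw [hv.map_sub_map hw hmono hhom] at hle
  have hsum : ∑ i, (F *ᵥ (w - v)) i = ∑ i, ((F *ᵥ 1) * (w - v)) i := by
    rw [← one_dotProduct, dotProduct_mulVec, ← hbal]
    rfl
  have heq : F *ᵥ (w - v) = (F *ᵥ 1) * (w - v) := funext fun i =>
    (Finset.sum_eq_sum_iff_of_le fun i _ => hle i).1 hsum i (Finset.mem_univ i)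
  refine ⟨⟨hF₀, fun y => ?_⟩, hbal⟩
  calc F *ᵥ (y - w) = F *ᵥ (y - v) - F *ᵥ (w - v) := by
        rw [← mulVec_sub, sub_sub_sub_cancel_right]
    _ ≤ (F *ᵥ 1) * (f y - f v) - (F *ᵥ 1) * (f w - f v) := by
        rw [heq, hv.map_sub_map hw hmono hhom]
        exact sub_le_sub_right (hF y) _
    _ = (F *ᵥ 1) * (f y - f w) := by rw [← mul_sub, sub_sub_sub_cancel_right]

theorem criticalGraph_congr (hconv : IsConvexMap f) (hmono : Monotone f)
    (hhom : IsAddHomogeneous f) (hv : IsEigenvector f v) (hw : IsEigenvector f w) :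
    criticalGraph f v = criticalGraph f w := by
  have hcirc : subgradientCirculations f v = subgradientCirculations f w :=
    (subgradientCirculations_le hmono hhom hv hw).antisymm
      (subgradientCirculations_le hmono hhom hw hv)
  have harc (i j) : (criticalGraph f v).Arc i j ↔ (criticalGraph f w).Arc i j := by
    rw [criticalGraph_arc_iff hconv hmono hhom, criticalGraph_arc_iff hconv hmono hhom, hcirc]
  refine NodeDigraph.ext (Set.ext fun i => ?_) (funext₂ fun i j => propext (harc i j))
  simp only [mem_criticalGraph_nodes_iff hmono hhom, harc]

theorem IsAddHomogeneous.iterate (hhom : IsAddHomogeneous f) (k : ℕ) : IsAddHomogeneous f^[k] :=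
  fun c => Function.Commute.iterate_left (hhom c) k

theorem IsEigenvector.iterate (hhom : IsAddHomogeneous f) (hv : IsEigenvector f v) (k : ℕ) :
    IsEigenvector f^[k] v := by
  obtain ⟨c, hc⟩ := hv
  induction k with
  | zero => exact ⟨0, by simp⟩
  | succ k ih =>
    obtain ⟨d, hd⟩ := ih
    refine ⟨d + c, ?_⟩
    rw [Function.iterate_succ_apply', hd, hhom, hc]
    simp only [add_assoc]

theorem isSubgradient_apply_map_iff {g : (Fin n → ℝ) → (Fin n → ℝ)} (hg : IsAddHomogeneous g)
    (hv : IsEigenvector f v) {i : Fin n} {l : Module.Dual ℝ (Fin n → ℝ)} :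
    IsSubgradient (fun y => g y i) (f v) l ↔ IsSubgradient (fun y => g y i) v l := by
  obtain ⟨c, hc⟩ := hv
  have hfv : f v = v + c • 1 := by
    ext j
    simp [hc, add_comm]
  rw [hfv]
  exact IsSubgradient.add_iff fun y => hg.add_smul_one c y i

theorem pow_mem_subdifferential_iterate (hmono : Monotone f) (hhom : IsAddHomogeneous f)
    (hv : IsEigenvector f v) {P : Matrix (Fin n) (Fin n) ℝ} (hP : P ∈ subdifferential f v)
    (k : ℕ) : P ^ k ∈ subdifferential f^[k] v := by
  have hstoch := mem_rowStochastic_of_mem_subdifferential hmono hhom hP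
  induction k with
  | zero => simp [subdifferential]
  | succ k ih =>
    rw [pow_succ, Function.iterate_succ]
    refine mul_mem_subdifferential_comp (mem_subdifferential_iff.2 fun i => ?_)
      (fun _ _ => nonneg_of_mem_rowStochastic (Submonoid.pow_mem _ hstoch k)) hP
    exact (isSubgradient_apply_map_iff (hhom.iterate k) hv).2 (mem_subdifferential_iff.1 ih i)

end Eigenvectors

/-! ### The critical graph of an iterate -/

section Iterate

variable {n : ℕ} {f : (Fin n → ℝ) → (Fin n → ℝ)} {v : Fin n → ℝ} {k : ℕ} {i j : Fin n}

/-- The flow `F` records how much mass crosses each arc when a unit of mass travels from `i` along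
`k` arcs and ends up distributed as `r`. -/
theorem exists_flow_of_isSubgradient_iterate (hconv : IsConvexMap f) (hmono : Monotone f)
    (hhom : IsAddHomogeneous f) (hv : IsEigenvector f v) {r : Fin n → ℝ}
    (hr : IsSubgradient (fun y => f^[k] y i) v (dotProductEquiv ℝ (Fin n) r)) :
    ∃ F ∈ subgradientFlows f v, F *ᵥ 1 + r = 1 ᵥ* F + Pi.single i 1 ∧
      ∀ j, r j ≠ 0 → (matrixGraph F).HasPath k i j := by
  induction k generalizing r with
  | zero =>
    have hri : r = Pi.single i 1 := (dotProductEquiv ℝ (Fin n)).injective <|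
      LinearMap.ext fun z => by
        rw [hr.apply_eq_of_forall_add_eq (e := z) (c := z i) fun y => rfl]
        simp
    refine ⟨0, zero_mem _, by simp [hri], fun j hj => ⟨Set.mem_univ i, ?_⟩⟩
    by_contra hij
    exact hj (hri ▸ Pi.single_eq_of_ne' hij 1)
  | succ k ih =>
    have hmono' : Monotone fun y => f^[k] y i := fun _ _ h => hmono.iterate k h i
    obtain ⟨p, hp, Q, hQ, rfl⟩ := hr.exists_eq_vecMul (hconv.iterate hmono k i)
      ((hconv.iterate hmono k).continuous_apply i) hmono' hconv
    have hp₀ : 0 ≤ p := hp.nonneg hmono'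
    obtain ⟨F, hF, hbal, hpath⟩ := ih ((isSubgradient_apply_map_iff (hhom.iterate k) hv).1 hp)
    have hpQ : diagonal p * Q ∈ subgradientFlows f v :=
      (mem_subgradientFlows_iff hconv hmono hhom).2 ⟨p, hp₀, Q, hQ, rfl⟩
    refine ⟨F + diagonal p * Q, add_mem hF hpQ, ?_, fun j hj => ?_⟩
    · rw [add_mulVec, vecMul_add, one_vecMul_diagonal_mul, diagonal_mul_mulVec_one p
        (one_vecMul_of_mem_rowStochastic
          (mem_rowStochastic_of_mem_subdifferential hmono hhom hQ))]
      linear_combination hbal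
    · obtain ⟨l, -, hl⟩ : ∃ l ∈ Finset.univ, p l * Q l j ≠ 0 :=
        Finset.exists_ne_zero_of_sum_ne_zero hj
      refine ⟨l, (hpath l (left_ne_zero_of_mul hl)).mono (fun a b hab => ?_) (Set.mem_univ i), ?_⟩
      · exact (add_pos_of_pos_of_nonneg ((hF.1 a b).lt_of_ne' hab) (hpQ.1 a b)).ne'
      · refine (add_pos_of_nonneg_of_pos (hF.1 l j) ((hpQ.1 l j).lt_of_ne' ?_)).ne'
        rwa [diagonal_mul]

theorem hasPath_criticalGraph_of_arc_iterate (hconv : IsConvexMap f) (hmono : Monotone f)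
    (hhom : IsAddHomogeneous f) (hv : IsEigenvector f v) (hk : 1 ≤ k)
    (hij : (criticalGraph f^[k] v).Arc i j) : (criticalGraph f v).HasPath k i j := by
  obtain ⟨k, rfl⟩ := Nat.exists_eq_add_of_le' hk
  obtain ⟨H, hH, hij⟩ := (criticalGraph_arc_iff (hconv.iterate hmono _) (hmono.iterate _)
    (hhom.iterate _)).1 hij
  obtain ⟨m, hm, R, hR, hinv, rfl⟩ := (mem_subgradientCirculations_iff (hconv.iterate hmono _)
    (hmono.iterate _) (hhom.iterate _)).1 hH
  rw [diagonal_mul] at hij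
  choose F hF hbal hpath using fun i => exists_flow_of_isSubgradient_iterate hconv hmono hhom hv
    (mem_subdifferential_iff.1 hR i)
  have hcirc : ∑ a, m a • F a ∈ subgradientCirculations f v := by
    refine ⟨sum_mem fun a _ => PointedCone.smul_mem _ (hm a) (hF a), ?_⟩
    have hsum : ∑ a, m a • (F a *ᵥ 1 + R a) = ∑ a, m a • (1 ᵥ* F a + Pi.single a 1) :=
      Finset.sum_congr rfl fun a _ => by rw [hbal]
    have hmR : ∑ a, m a • R a = m := (vecMul_eq_sum m R).symm.trans hinv
    have hm₁ : ∑ a, m a • Pi.single a 1 = m := (pi_eq_sum_univ' m).symm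
    simp only [smul_add, Finset.sum_add_distrib, hmR, hm₁] at hsum
    rw [sum_mulVec, vecMul_sum]
    simpa only [smul_mulVec, vecMul_smul] using add_right_cancel hsum
  have harc (a b) (hab : F i a b ≠ 0) : (criticalGraph f v).Arc a b := by
    refine (criticalGraph_arc_iff hconv hmono hhom).2 ⟨_, hcirc, ?_⟩
    rw [Matrix.sum_apply]
    exact (Finset.sum_pos' (fun c _ => mul_nonneg (hm c) ((hF c).1 a b)) ⟨i, Finset.mem_univ i,
      mul_pos ((hm i).lt_of_ne' (left_ne_zero_of_mul hij)) (((hF i).1 a b).lt_of_ne' hab)⟩).ne'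
  have hpath := hpath i j (right_ne_zero_of_mul hij)
  obtain ⟨l, hil⟩ := hpath.exists_arc_left
  exact hpath.mono harc (NodeDigraph.left_mem _ (harc i l hil))

theorem pow_pos_of_hasPath {P : Matrix (Fin n) (Fin n) ℝ} (hP : ∀ a b, 0 ≤ P a b)
    (h : (matrixGraph P).HasPath k i j) : 0 < (P ^ k) i j := by
  induction k generalizing j with
  | zero => simp [h.2]
  | succ k ih =>
    obtain ⟨l, hil, hlj⟩ := h
    rw [pow_succ, mul_apply]
    exact Finset.sum_pos' (fun a _ => mul_nonneg (pow_apply_nonneg hP k i a) (hP a j))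
      ⟨l, Finset.mem_univ l, mul_pos (ih hil) ((hP l j).lt_of_ne' hlj)⟩

theorem arc_criticalGraph_iterate_of_hasPath (hconv : IsConvexMap f) (hmono : Monotone f)
    (hhom : IsAddHomogeneous f) (hv : IsEigenvector f v) (hk : 1 ≤ k)
    (hij : (criticalGraph f v).HasPath k i j) : (criticalGraph f^[k] v).Arc i j := by
  obtain ⟨k, rfl⟩ := Nat.exists_eq_add_of_le' hk
  obtain ⟨F, hF, hFarc⟩ := exists_maximal_circulation hconv hmono hhom v
  obtain ⟨m, hm, P, hP, hinv, rfl⟩ := (mem_subgradientCirculations_iff hconv hmono hhom).1 hF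
  simp only [diagonal_mul, mul_ne_zero_iff] at hFarc
  obtain ⟨l, hil⟩ := hij.exists_arc_left
  have hpow : (diagonal m * P ^ (k + 1)) i j ≠ 0 := by
    rw [diagonal_mul]
    exact mul_ne_zero (hFarc i l hil).1 (pow_pos_of_hasPath
      (mem_rowStochastic.1 (mem_rowStochastic_of_mem_subdifferential hmono hhom hP)).1
      (hij.mono (fun a b hab => (hFarc a b hab).2) (Set.mem_univ i))).ne'
  have hinv_pow (q : ℕ) : m ᵥ* P ^ q = m := by
    induction q with
    | zero => simp
    | succ q ih => rw [pow_succ, ← vecMul_vecMul, ih, hinv]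
  exact (criticalGraph_arc_iff (hconv.iterate hmono _) (hmono.iterate _) (hhom.iterate _)).2 ⟨_,
    (mem_subgradientCirculations_iff (hconv.iterate hmono _) (hmono.iterate _)
      (hhom.iterate _)).2 ⟨m, hm, _, pow_mem_subdifferential_iterate hmono hhom hv hP _,
        hinv_pow _, rfl⟩, hpow⟩

theorem criticalGraph_iterate (hconv : IsConvexMap f) (hmono : Monotone f)
    (hhom : IsAddHomogeneous f) (hv : IsEigenvector f v) (hk : 1 ≤ k) :
    criticalGraph f^[k] v = criticalGraph f v ^ k := by
  have harc (i j) : (criticalGraph f^[k] v).Arc i j ↔ (criticalGraph f v).HasPath k i j :=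
    ⟨hasPath_criticalGraph_of_arc_iterate hconv hmono hhom hv hk,
      arc_criticalGraph_iterate_of_hasPath hconv hmono hhom hv hk⟩
  refine NodeDigraph.ext (Set.ext fun i => ?_) (funext₂ fun i j => propext (harc i j))
  simp only [mem_criticalGraph_nodes_iff (hmono.iterate k) (hhom.iterate k), harc]
  exact ⟨fun ⟨j, hij⟩ => hij.left_mem, fun hi => NodeDigraph.exists_hasPath
    (fun _ => (mem_criticalGraph_nodes_iff hmono hhom).1) hi k⟩

end Iterate

end ConvexSpectral

theorem theorem4p1 {n : ℕ} (f : (Fin n → ℝ) → (Fin n → ℝ))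
    (hconv : ConvexSpectral.IsConvexMap f) (hmono : Monotone f)
    (hhom : ConvexSpectral.IsAddHomogeneous f)
    (heig : ∃ v, ConvexSpectral.IsEigenvector f v) (k : ℕ) (hk : 1 ≤ k) :
    (∃ w, ConvexSpectral.IsEigenvector f^[k] w) ∧
    ∀ v w, ConvexSpectral.IsEigenvector f v → ConvexSpectral.IsEigenvector f^[k] w →
      ConvexSpectral.criticalGraph f^[k] w = ConvexSpectral.criticalGraph f v ^ k ∧
      ConvexSpectral.criticalNodes f^[k] w = ConvexSpectral.criticalNodes f v := by
  obtain ⟨u, hu⟩ := heig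
  refine ⟨⟨u, hu.iterate hhom k⟩, fun v w hv hw => ?_⟩
  have hgraph : ConvexSpectral.criticalGraph f^[k] w = ConvexSpectral.criticalGraph f v ^ k := by
    rw [ConvexSpectral.criticalGraph_congr (hconv.iterate hmono k) (hmono.iterate k)
      (hhom.iterate k) hw (hv.iterate hhom k),
      ConvexSpectral.criticalGraph_iterate hconv hmono hhom hv hk]
  refine ⟨hgraph, ?_⟩
  rw [ConvexSpectral.criticalNodes, hgraph]
  rfl
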